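/- Let $n\ge 1$ and let $(M,g)$ be a smooth Riemannian manifold of dimension $2n+1$ with Levi-Civita connection $\nabla$. Let $\varphi,Q$ be smooth $(1,1)$-tensor fields, $\xi$ a smooth vector field and $\eta$ a smooth 1-form on $M$ such that $Q$ is nonsingular and $$\varphi^2=-Q+\eta\otimes\xi,\quad \eta(\xi)=1,\quad Q\xi=\xi,\quad \varphi(\ker\eta)\subset\ker\eta,\quad g(\varphi X,\varphi Y)=g(X,QY)-\eta(X)\eta(Y)$$ for all vector fields $X,Y$ (that is, $(\varphi,Q,\xi,\eta,g)$ is a weak almost contact metric structure). Assume that it is weak nearly Sasakian, i.e. $(\nabla_Y\varphi)Y=g(Y,Y)\,\xi-\eta(Y)\,Y$ for all smooth vector fields $Y$. Put $h=\nabla\xi+\varphi$ and $\widetilde Q=Q-\mathrm{id}_{TM}$. Then: (1) $h=0$ if and only if $(\varphi,\xi,\eta,g)$ is a Sasakian structure, i.e. an almost contact metric structure (a weak almost contact metric structure with $\mathrm{id}_{TM}$ in place of $Q$) with $(\nabla_X\varphi)Y=g(X,Y)\,\xi-\eta(Y)\,X$ for all smooth vector fields $X,Y$. (2) If $h=0$,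 then $\widetilde Q=0$; $d\eta(X,Y)=g(X,\varphi Y)$ for all smooth vector fields $X,Y$, where $d\eta(X,Y)=\frac12\{X(\eta(Y))-Y(\eta(X))-\eta([X,Y])\}$ (the structure is a weak contact metric structure); $\eta$ is a contact form, i.e. $\eta\wedge(d\eta)^n$ vanishes nowhere; and every sectional curvature of a plane containing $\xi$ equals $1$. -/

import Mathlib

open Bundle VectorField FiberBundle
open scoped Manifold ContDiff

noncomputable section

namespace WeakContact

section LeviCivita

variable {E : Type*} [NormedAddCommGroup E] [NormedSpace ℝ E] [FiniteDimensional ℝ E]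
  {H : Type*} [TopologicalSpace H] {I : ModelWithCorners ℝ E H}
  {M : Type*} [TopologicalSpace M] [ChartedSpace H M] [IsManifold I ∞ M]
  [RiemannianBundle (fun x : M ↦ TangentSpace I x)]
  [IsContMDiffRiemannianBundle I ∞ E (fun x : M ↦ TangentSpace I x)]

/-- The function `g(X, Y)` on the manifold. -/
def ip (X Y : Π x : M, TangentSpace I x) : M → ℝ := fun x ↦ inner ℝ (X x) (Y x)

lemma ip_comm (X Y : Π x : M, TangentSpace I x) : ip X Y = ip Y X := by
  funext x; exact real_inner_comm _ _

/-- The Koszul expression, i.e. the value of `g(∇_X Y, Z)` at `x` (the differentiated field `Y` is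
the first argument). -/
def koszul (Y X Z : Π x : M, TangentSpace I x) (x : M) : ℝ :=
  (1 / 2) * (mvfderiv I (ip Y Z) x (X x) + mvfderiv I (ip Z X) x (Y x)
    - mvfderiv I (ip X Y) x (Z x)
    + inner ℝ (mlieBracket I X Y x) (Z x) - inner ℝ (mlieBracket I Y Z x) (X x)
    - inner ℝ (mlieBracket I X Z x) (Y x))

variable {X X' Y Z Z' : Π x : M, TangentSpace I x} {x : M} {f : M → ℝ}

lemma mdiff_ip (hX : MDiffAt (T% X) x) (hY : MDiffAt (T% Y) x) : MDiffAt (ip X Y) x :=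
  by
  have := @MDifferentiableAt.inner_bundle E _ _ H _ I M _ _ E _ _ (fun x : M ↦ TangentSpace I x) _ _ _ _ _ E _ _ H _ I M _ _ _ id X Y x hX hY
  exact this

lemma mvfderiv_ip_add_left (hX : MDiffAt (T% X) x) (hX' : MDiffAt (T% X') x)
    (hY : MDiffAt (T% Y) x) :
    mvfderiv I (ip (X + X') Y) x = mvfderiv I (ip X Y) x + mvfderiv I (ip X' Y) x := by
  rw [← mvfderiv_add (mdiff_ip hX hY) (mdiff_ip hX' hY)]
  congr 1
  funext y
  simp [ip, inner_add_left]

lemma mvfderiv_ip_smul_left (hf : MDiffAt f x) (hX : MDiffAt (T% X) x) (hY : MDiffAt (T% Y) x) :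
    mvfderiv I (ip (f • X) Y) x
      = f x • mvfderiv I (ip X Y) x + ip X Y x • mvfderiv I f x := by
  rw [← mvfderiv_mul hf (mdiff_ip hX hY)]
  congr 1
  funext y
  simp [ip, inner_smul_left]

lemma mvfderiv_ip_add_right (hX : MDiffAt (T% X) x) (hX' : MDiffAt (T% X') x)
    (hY : MDiffAt (T% Y) x) :
    mvfderiv I (ip Y (X + X')) x = mvfderiv I (ip Y X) x + mvfderiv I (ip Y X') x := by
  rw [ip_comm, mvfderiv_ip_add_left hX hX' hY, ip_comm X, ip_comm X']

lemma mvfderiv_ip_smul_right (hf : MDiffAt f x) (hX : MDiffAt (T% X) x) (hY : MDiffAt (T% Y) x) :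
    mvfderiv I (ip Y (f • X)) x
      = f x • mvfderiv I (ip Y X) x + ip Y X x • mvfderiv I f x := by
  rw [ip_comm, mvfderiv_ip_smul_left hf hX hY, ip_comm X]

lemma koszul_tensorial_left (hY : MDiffAt (T% Y) x) (hZ : MDiffAt (T% Z) x) :
    TensorialAt I E (fun X ↦ koszul Y X Z x) x where
  smul {f X} hf hX := by
    simp only [koszul, mvfderiv_ip_smul_right hf hX hZ, mvfderiv_ip_smul_left hf hX hY,
      mlieBracket_smul_left hf hX]
    simp [ip, inner_add_left, inner_smul_left, inner_smul_right, real_inner_comm (X x)]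
    ring
  add {X X'} hX hX' := by
    simp only [koszul, mvfderiv_ip_add_right hX hX' hZ, mvfderiv_ip_add_left hX hX' hY,
      mlieBracket_add_left hX hX']
    simp [inner_add_left, inner_add_right]
    ring

lemma koszul_tensorial_right (hY : MDiffAt (T% Y) x) (hX : MDiffAt (T% X) x) :
    TensorialAt I E (fun Z ↦ koszul Y X Z x) x where
  smul {f Z} hf hZ := by
    simp only [koszul, mvfderiv_ip_smul_right hf hZ hY, mvfderiv_ip_smul_left hf hZ hX,
      mlieBracket_smul_right hf hZ]
    simp [ip, inner_add_left, inner_smul_left, inner_smul_right, real_inner_comm (Z x)]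
    ring
  add {Z Z'} hZ hZ' := by
    simp only [koszul, mvfderiv_ip_add_right hZ hZ' hY, mvfderiv_ip_add_left hZ hZ' hX,
      mlieBracket_add_right hZ hZ']
    simp [inner_add_left, inner_add_right]
    ring

open Classical in
/-- At a point where `Y` is differentiable, `leviCivitaFun Y x u` is the vector `∇_u Y` determined
by the Koszul formula `g(∇_X Y, Z) = koszul Y X Z` (see `inner_leviCivitaFun`); elsewhere it is the
junk value `0`. -/
def leviCivitaFun (Y : Π x : M, TangentSpace I x) (x : M) :
    TangentSpace I x →L[ℝ] TangentSpace I x :=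
  if hY : MDiffAt (T% Y) x then
    haveI : FiniteDimensional ℝ (TangentSpace I x) := inferInstanceAs (FiniteDimensional ℝ E)
    haveI : CompleteSpace (TangentSpace I x) := FiniteDimensional.complete ℝ _
    let B := TensorialAt.mkHom₂ (I := I) (F := E) (F' := E) (fun X Z ↦ koszul Y X Z x) x
      (fun _ hZ ↦ koszul_tensorial_left hY hZ) (fun _ hX ↦ koszul_tensorial_right hY hX)
    LinearMap.toContinuousLinearMap
      { toFun := fun u ↦ (InnerProductSpace.toDual ℝ (TangentSpace I x)).symm (B u)
        map_add' := fun u v ↦ by simp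
        map_smul' := fun c u ↦ by simp }
  else 0

lemma inner_leviCivitaFun (hY : MDiffAt (T% Y) x) (hX : MDiffAt (T% X) x)
    (hZ : MDiffAt (T% Z) x) :
    inner ℝ (leviCivitaFun Y x (X x)) (Z x) = koszul Y X Z x := by
  rw [← TensorialAt.mkHom₂_apply (I := I) (F := E) (F' := E) (Φ := fun X Z ↦ koszul Y X Z x)
      (fun _ hZ ↦ koszul_tensorial_left hY hZ) (fun _ hX ↦ koszul_tensorial_right hY hX) hX hZ]
  simp [leviCivitaFun, hY]


lemma eq_of_inner_fields {u v : TangentSpace I x}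
    (h : ∀ Z : Π x : M, TangentSpace I x, MDiffAt (T% Z) x → inner ℝ u (Z x) = inner ℝ v (Z x)) :
    u = v := by
  refine ext_inner_right ℝ fun w ↦ ?_
  have := h (extend E w) (mdifferentiableAt_extend ..)
  simpa using this

lemma clm_eq_of_fields {A B : TangentSpace I x →L[ℝ] TangentSpace I x}
    (h : ∀ X Z : Π x : M, TangentSpace I x, MDiffAt (T% X) x → MDiffAt (T% Z) x →
      inner ℝ (A (X x)) (Z x) = inner ℝ (B (X x)) (Z x)) : A = B := by
  ext u
  refine eq_of_inner_fields fun Z hZ ↦ ?_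
  simpa using h (extend E u) Z (mdifferentiableAt_extend ..) hZ

variable (I M) in
/-- The Levi-Civita connection of the Riemannian metric: `leviCivita I M Y x u` is `∇_u Y` at `x`.
It is torsion-free and metric, see `leviCivita_torsion` and `leviCivita_metric`. -/
def leviCivita : CovariantDerivative I E (fun x : M ↦ TangentSpace I x) where
  toFun := leviCivitaFun
  isCovariantDerivativeOnUniv :=
    { add := by
        intro Y Y' x hY hY' _
        refine clm_eq_of_fields fun X Z hX hZ ↦ ?_
        have hs : MDiffAt (T% (Y + Y')) x := mdifferentiableAt_add_section hY hY'
        rw [inner_leviCivitaFun hs hX hZ]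
        simp only [add_apply, inner_add_left]
        rw [inner_leviCivitaFun hY hX hZ, inner_leviCivitaFun hY' hX hZ]
        simp only [koszul, mvfderiv_ip_add_right hY hY' hX, mvfderiv_ip_add_left hY hY' hZ,
          mlieBracket_add_left hY hY', mlieBracket_add_right hY hY']
        simp [inner_add_left, inner_add_right]
        ring
      leibniz := by
        intro Y f x hY hf _
        refine clm_eq_of_fields fun X Z hX hZ ↦ ?_
        have hs : MDiffAt (T% (f • Y)) x := hf.smul_section hY
        rw [inner_leviCivitaFun hs hX hZ]
        simp only [add_apply, inner_add_left]
        simp only [smul_apply, inner_smul_left]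
        rw [inner_leviCivitaFun hY hX hZ]
        simp only [koszul, mvfderiv_ip_smul_right hf hY hX, mvfderiv_ip_smul_left hf hY hZ,
          mlieBracket_smul_left hf hY, mlieBracket_smul_right hf hY]
        simp [ip, inner_add_left, inner_smul_left, inner_smul_right, real_inner_comm (X x) (Y x)]
        ring }

lemma leviCivita_torsion : (leviCivita I M).torsion = 0 := by
  rw [CovariantDerivative.torsion_eq_zero_iff]
  intro X Y x hX hY
  refine eq_of_inner_fields fun Z hZ ↦ ?_
  rw [inner_sub_left]
  erw [inner_leviCivitaFun hY hX hZ, inner_leviCivitaFun hX hY hZ]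
  simp only [koszul, ip_comm Y Z, ip_comm Z X, ip_comm Y X, mlieBracket_swap_apply (V := Y) (W := X)]
  simp
  ring

lemma leviCivita_metric (hY : MDiffAt (T% Y) x) (hZ : MDiffAt (T% Z) x) (u : TangentSpace I x) :
    mvfderiv I (ip Y Z) x u
      = inner ℝ (leviCivita I M Y x u) (Z x) + inner ℝ (Y x) (leviCivita I M Z x u) := by
  have hu : MDiffAt (T% (extend E u)) x := mdifferentiableAt_extend ..
  have h₁ := inner_leviCivitaFun hY hu hZ
  have h₂ := inner_leviCivitaFun hZ hu hY
  rw [extend_apply_self] at h₁ h₂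
  change _ = inner ℝ (leviCivitaFun Y x u) (Z x) + inner ℝ (Y x) (leviCivitaFun Z x u)
  rw [h₁, real_inner_comm, h₂]
  simp only [koszul, ip_comm Z Y, ip_comm Z (extend E u), ip_comm (extend E u) Y,
    mlieBracket_swap_apply (V := Z) (W := Y), extend_apply_self, inner_neg_left]
  ring

end LeviCivita

/-! ### Vector fields, endomorphism fields, one-forms -/

section Tensors

variable {E : Type*} [NormedAddCommGroup E] [NormedSpace ℝ E]
  {H : Type*} [TopologicalSpace H] {I : ModelWithCorners ℝ E H}
  {M : Type*} [TopologicalSpace M] [ChartedSpace H M] [IsManifold I ∞ M]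

/-- `X` is a smooth vector field. -/
def IsSmoothField (X : Π x : M, TangentSpace I x) : Prop :=
  ContMDiff I I.tangent ∞ (fun x ↦ (⟨x, X x⟩ : TangentBundle I M))

/-- `A` is a smooth `(1,1)`-tensor field. -/
def IsSmoothEnd (A : Π x : M, TangentSpace I x →L[ℝ] TangentSpace I x) : Prop :=
  ContMDiff I (I.prod 𝓘(ℝ, E →L[ℝ] E)) ∞
    (fun x ↦ TotalSpace.mk' (E →L[ℝ] E)
      (E := fun x : M ↦ TangentSpace I x →L[ℝ] TangentSpace I x) x (A x))

/-- `η` is a smooth 1-form. -/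
def IsSmoothForm (η : Π x : M, TangentSpace I x →L[ℝ] ℝ) : Prop :=
  ContMDiff I (I.prod 𝓘(ℝ, E →L[ℝ] ℝ)) ∞
    (fun x ↦ TotalSpace.mk' (E →L[ℝ] ℝ) (E := fun x : M ↦ TangentSpace I x →L[ℝ] ℝ) x (η x))

/-- The exterior derivative `dη(X, Y) = ½ (X(η(Y)) - Y(η(X)) - η([X, Y]))`. -/
def extD (η : Π x : M, TangentSpace I x →L[ℝ] ℝ) (X Y : Π x : M, TangentSpace I x) (x : M) : ℝ :=
  (1 / 2) * (mvfderiv I (fun y ↦ η y (Y y)) x (X x) - mvfderiv I (fun y ↦ η y (X y)) x (Y x)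
    - η x (mlieBracket I X Y x))

/-- The value of `η ∧ (dη)ⁿ` on the vector fields `X₀, …, X₂ₙ`, at the point `x`. Like `extD`, it
uses the normalization in which a wedge product is the full antisymmetrization (with the factor
`1 / (2n+1)!`) of the tensor product. -/
def wedgeContact (n : ℕ) (η : Π x : M, TangentSpace I x →L[ℝ] ℝ)
    (X : Fin (2 * n + 1) → Π x : M, TangentSpace I x) (x : M) : ℝ :=
  (1 / ((2 * n + 1).factorial : ℝ)) * ∑ σ : Equiv.Perm (Fin (2 * n + 1)),
    ((Equiv.Perm.sign σ : ℤ) : ℝ) * (η x (X (σ 0) x) *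
      ∏ i : Fin n, extD η (X (σ ⟨2 * i.1 + 1, by omega⟩)) (X (σ ⟨2 * i.1 + 2, by omega⟩)) x)

/-- `η` is a contact form on a `(2n+1)`-manifold: `η ∧ (dη)ⁿ` vanishes at no point. -/
def IsContactForm (n : ℕ) (η : Π x : M, TangentSpace I x →L[ℝ] ℝ) : Prop :=
  ∀ x : M, ∃ X : Fin (2 * n + 1) → Π x : M, TangentSpace I x,
    (∀ i, IsSmoothField (X i)) ∧ wedgeContact n η X x ≠ 0

/-- A weak almost contact structure `(φ, Q, ξ, η)`. -/
structure IsWeakAlmostContact (φ Q : Π x : M, TangentSpace I x →L[ℝ] TangentSpace I x)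
    (ξ : Π x : M, TangentSpace I x) (η : Π x : M, TangentSpace I x →L[ℝ] ℝ) : Prop where
  smooth_phi : IsSmoothEnd φ
  smooth_Q : IsSmoothEnd Q
  smooth_xi : IsSmoothField ξ
  smooth_eta : IsSmoothForm η
  nonsingular : ∀ x, Function.Bijective (Q x)
  phi_sq : ∀ x (u : TangentSpace I x), φ x (φ x u) = -Q x u + η x u • ξ x
  eta_xi : ∀ x, η x (ξ x) = 1
  Q_xi : ∀ x, Q x (ξ x) = ξ x
  ker_invariant : ∀ x (u : TangentSpace I x), η x u = 0 → η x (φ x u) = 0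

end Tensors

/-! ### Metric structures -/

section Metric

variable {E : Type*} [NormedAddCommGroup E] [NormedSpace ℝ E] [FiniteDimensional ℝ E]
  {H : Type*} [TopologicalSpace H] {I : ModelWithCorners ℝ E H}
  {M : Type*} [TopologicalSpace M] [ChartedSpace H M] [IsManifold I ∞ M]
  [RiemannianBundle (fun x : M ↦ TangentSpace I x)]
  [IsContMDiffRiemannianBundle I ∞ E (fun x : M ↦ TangentSpace I x)]

/-- The vector field `∇_X Y`. -/
def nabla (X Y : Π x : M, TangentSpace I x) : Π x : M, TangentSpace I x :=
  fun x ↦ leviCivita I M Y x (X x)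

/-- `(∇_X φ) Y = ∇_X (φ Y) - φ (∇_X Y)`. -/
def nablaEnd (φ : Π x : M, TangentSpace I x →L[ℝ] TangentSpace I x)
    (X Y : Π x : M, TangentSpace I x) : Π x : M, TangentSpace I x :=
  fun x ↦ nabla X (fun y ↦ φ y (Y y)) x - φ x (nabla X Y x)

/-- `R_{X,Y} Z = ∇_X ∇_Y Z - ∇_Y ∇_X Z - ∇_{[X,Y]} Z`. -/
def curvature (X Y Z : Π x : M, TangentSpace I x) : Π x : M, TangentSpace I x :=
  fun x ↦ nabla X (nabla Y Z) x - nabla Y (nabla X Z) x - nabla (mlieBracket I X Y) Z x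

/-- The sectional curvature at `x` of the plane spanned by `X x` and `Y x`. -/
def sectionalCurvature (X Y : Π x : M, TangentSpace I x) (x : M) : ℝ :=
  (inner ℝ (curvature X Y Y x) (X x) : ℝ) /
    ((inner ℝ (X x) (X x) : ℝ) * inner ℝ (Y x) (Y x) - (inner ℝ (X x) (Y x) : ℝ) ^ 2)

/-- A weak almost contact metric structure `(φ, Q, ξ, η, g)`. -/
structure IsWeakAlmostContactMetric (φ Q : Π x : M, TangentSpace I x →L[ℝ] TangentSpace I x)
    (ξ : Π x : M, TangentSpace I x) (η : Π x : M, TangentSpace I x →L[ℝ] ℝ) : Prop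
    extends IsWeakAlmostContact φ Q ξ η where
  compatible : ∀ x (u v : TangentSpace I x),
    (inner ℝ (φ x u) (φ x v) : ℝ) = inner ℝ u (Q x v) - η x u * η x v

/-- A weak contact metric structure: `dη(X, Y) = g(X, φ Y)`. -/
structure IsWeakContactMetric (φ Q : Π x : M, TangentSpace I x →L[ℝ] TangentSpace I x)
    (ξ : Π x : M, TangentSpace I x) (η : Π x : M, TangentSpace I x →L[ℝ] ℝ) : Prop
    extends IsWeakAlmostContactMetric φ Q ξ η where
  extD_eq : ∀ X Y : Π x : M, TangentSpace I x, IsSmoothField X → IsSmoothField Y →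
    ∀ x, extD η X Y x = inner ℝ (X x) (φ x (Y x))

/-- A weak nearly Sasakian structure: `(∇_Y φ) Y = g(Y, Y) ξ - η(Y) Y`. -/
structure IsWeakNearlySasakian (φ Q : Π x : M, TangentSpace I x →L[ℝ] TangentSpace I x)
    (ξ : Π x : M, TangentSpace I x) (η : Π x : M, TangentSpace I x →L[ℝ] ℝ) : Prop
    extends IsWeakAlmostContactMetric φ Q ξ η where
  nearly : ∀ Y : Π x : M, TangentSpace I x, IsSmoothField Y →
    ∀ x, nablaEnd φ Y Y x = (inner ℝ (Y x) (Y x) : ℝ) • ξ x - η x (Y x) • Y x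

/-- An almost contact metric structure is a weak one with `Q = id`. -/
def IsAlmostContactMetric (φ : Π x : M, TangentSpace I x →L[ℝ] TangentSpace I x)
    (ξ : Π x : M, TangentSpace I x) (η : Π x : M, TangentSpace I x →L[ℝ] ℝ) : Prop :=
  IsWeakAlmostContactMetric φ (fun x ↦ ContinuousLinearMap.id ℝ (TangentSpace I x)) ξ η

/-- A Sasakian structure `(φ, ξ, η, g)`: an almost contact metric structure with
`(∇_X φ) Y = g(X, Y) ξ - η(Y) X`. -/
structure IsSasakian (φ : Π x : M, TangentSpace I x →L[ℝ] TangentSpace I x)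
    (ξ : Π x : M, TangentSpace I x) (η : Π x : M, TangentSpace I x →L[ℝ] ℝ) : Prop where
  almostContactMetric : IsAlmostContactMetric φ ξ η
  sasaki : ∀ X Y : Π x : M, TangentSpace I x, IsSmoothField X → IsSmoothField Y →
    ∀ x, nablaEnd φ X Y x = (inner ℝ (X x) (Y x) : ℝ) • ξ x - η x (Y x) • X x

/-- The tensor `h = ∇ξ + φ`. -/
def hTensor (φ : Π x : M, TangentSpace I x →L[ℝ] TangentSpace I x)
    (ξ : Π x : M, TangentSpace I x) : Π x : M, TangentSpace I x →L[ℝ] TangentSpace I x :=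
  fun x ↦ leviCivita I M ξ x + φ x

/-- The tensor `Q̃ = Q - id`. -/
def QTilde (Q : Π x : M, TangentSpace I x →L[ℝ] TangentSpace I x) :
    Π x : M, TangentSpace I x →L[ℝ] TangentSpace I x :=
  fun x ↦ Q x - ContinuousLinearMap.id ℝ (TangentSpace I x)

end Metric

end WeakContact

end

/-!
Let `Φ(X, Y) = g(X, φ Y)`. If `h = 0`, i.e. `∇ξ = -φ`, then `dη = Φ` because `∇` is torsion-free and
metric, so `dΦ = 0`; as `φ` is skew, this says that the cyclic sum of `g(X, (∇_Y φ) Z)` vanishes.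
The polarized nearly Sasakian condition prescribes the part of `(∇_X φ) Y` symmetric in `X` and `Y`,
and the two together force `(∇_X φ) Y = g(X, Y) ξ - η(Y) X`. For `Y = ξ` the left side is `φ² X`,
which gives `Q = id`. Conversely, on a Sasakian manifold `Y = ξ` gives `φ (h X) = 0`, while `h X` is
orthogonal to `ξ` since `ξ` is a unit field.

Contact property: `φ` has at every point an adapted basis `ξ, eᵢ, φ eᵢ`, in which `dη` restricted to
`ker η` is the standard symplectic matrix. All nonzero terms of its Pfaffian sum have the same sign,
so `η ∧ (dη)ⁿ` is nonzero. Curvature: `∇ξ = -φ` turns `R_{X,ξ} ξ` into `(∇_ξ φ) X - φ² X`, which is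
`X - η(X) ξ` in the Sasakian case.
-/

noncomputable section

namespace WeakContact

section VectorFields

variable {E : Type*} [NormedAddCommGroup E] [NormedSpace ℝ E]
  {H : Type*} [TopologicalSpace H] {I : ModelWithCorners ℝ E H}
  {M : Type*} [TopologicalSpace M] [ChartedSpace H M]

/-- The derivative `X f` of a function `f` along a vector field `X`. -/
def derivAlong (X : Π x : M, TangentSpace I x) (f : M → ℝ) : M → ℝ :=
  fun x ↦ mvfderiv I f x (X x)

variable {f g : M → ℝ}

lemma derivAlong_sub (X : Π x : M, TangentSpace I x) (hf : ContMDiff I 𝓘(ℝ) ∞ f)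
    (hg : ContMDiff I 𝓘(ℝ) ∞ g) : derivAlong X (f - g) = derivAlong X f - derivAlong X g := by
  funext x
  simp [derivAlong, mvfderiv_sub ((hf x).mdifferentiableAt (by simp))
    ((hg x).mdifferentiableAt (by simp))]

lemma derivAlong_neg (X : Π x : M, TangentSpace I x) (f : M → ℝ) :
    derivAlong X (-f) = -derivAlong X f := by
  funext x
  simp [derivAlong, mvfderiv_neg]

lemma derivAlong_const_smul (X : Π x : M, TangentSpace I x) (c : ℝ)
    (hf : ContMDiff I 𝓘(ℝ) ∞ f) : derivAlong X (c • f) = c • derivAlong X f := by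
  funext x
  have := mvfderiv_mul (mdifferentiableAt_const (c := c)) ((hf x).mdifferentiableAt (by simp))
  rw [mvfderiv_const, smul_zero, add_zero] at this
  exact congrArg (fun A ↦ A (X x)) this

variable [IsManifold I ∞ M] {X Y Z W : Π x : M, TangentSpace I x}

lemma IsSmoothField.mdiffAt (hX : IsSmoothField X) (x : M) : MDiffAt (T% X) x :=
  (hX x).mdifferentiableAt (by simp)

lemma IsSmoothField.add (hX : IsSmoothField X) (hY : IsSmoothField Y) : IsSmoothField (X + Y) :=
  ContMDiff.add_section hX hY

lemma IsSmoothField.smul (hf : ContMDiff I 𝓘(ℝ) ∞ f) (hX : IsSmoothField X) :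
    IsSmoothField (f • X) :=
  ContMDiff.smul_section hf hX

lemma IsSmoothEnd.apply {φ : Π x : M, TangentSpace I x →L[ℝ] TangentSpace I x}
    (hφ : IsSmoothEnd φ) (hX : IsSmoothField X) : IsSmoothField (fun x ↦ φ x (X x)) :=
  ContMDiff.clm_bundle_apply (b := id) hφ hX

lemma IsSmoothForm.apply {η : Π x : M, TangentSpace I x →L[ℝ] ℝ}
    (hη : IsSmoothForm η) (hX : IsSmoothField X) : ContMDiff I 𝓘(ℝ) ∞ fun x ↦ η x (X x) := by
  intro x
  have hη' : ContMDiffAt I (I.prod 𝓘(ℝ, E →L[ℝ] ℝ)) ∞ (fun x ↦ TotalSpace.mk' (E →L[ℝ] ℝ)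
    (E := fun x : M ↦ TangentSpace I x →L[ℝ] Trivial M ℝ x) x (η x)) x := hη x
  have := ContMDiffAt.clm_bundle_apply (b := id) (E₁ := fun x : M ↦ TangentSpace I x)
    (E₂ := Trivial M ℝ) hη' (hX x)
  exact (contMDiffAt_totalSpace.1 this).2

lemma IsSmoothField.derivAlong (hX : IsSmoothField X) (hf : ContMDiff I 𝓘(ℝ) ∞ f) :
    ContMDiff I 𝓘(ℝ) ∞ (derivAlong X f) :=
  (contMDiff_snd_tangentBundle_modelSpace ℝ 𝓘(ℝ)).comp
    ((hf.contMDiff_tangentMap (m := ∞) (by simp)).comp hX)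

section Bracket

variable [CompleteSpace E]

lemma IsSmoothField.mlieBracket (hX : IsSmoothField X) (hY : IsSmoothField Y) :
    IsSmoothField (mlieBracket I X Y) := by
  have : IsManifold I (∞ + 1) M := by simpa using ‹IsManifold I ∞ M›
  have : IsManifold I (minSmoothness ℝ 2) M :=
    IsManifold.of_le (n := ∞) (by simpa using ENat.LEInfty.out)
  exact fun x ↦ ContMDiffAt.mlieBracket_vectorField (m := ⊤) (n := ⊤) (hX x) (hY x) (by simp)

lemma mlieBracket_jacobi (hX : IsSmoothField X) (hY : IsSmoothField Y) (hZ : IsSmoothField Z) :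
    mlieBracket I X (mlieBracket I Y Z)
      = mlieBracket I (mlieBracket I X Y) Z + mlieBracket I Y (mlieBracket I X Z) := by
  have : IsManifold I (minSmoothness ℝ 3) M :=
    IsManifold.of_le (n := ∞) (by simpa using ENat.LEInfty.out)
  have two {V : Π x : M, TangentSpace I x} (hV : IsSmoothField V) (x : M) :
      CMDiffAt (minSmoothness ℝ 2) (T% V) x := by
    simpa using (hV x).of_le (m := 2) ENat.LEInfty.out
  funext x
  exact leibniz_identity_mlieBracket_apply (two hX x) (two hY x) (two hZ x)

lemma mlieBracket_smul (hf : ContMDiff I 𝓘(ℝ) ∞ f) (hW : IsSmoothField W)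
    (X : Π x : M, TangentSpace I x) :
    mlieBracket I X (f • W) = derivAlong X f • W + f • mlieBracket I X W := by
  funext x
  simpa [derivAlong] using
    mlieBracket_smul_right (V := X) ((hf x).mdifferentiableAt (by simp)) (hW.mdiffAt x)

lemma mlieBracket_mlieBracket_smul (X : Π x : M, TangentSpace I x) (hY : IsSmoothField Y)
    (hf : ContMDiff I 𝓘(ℝ) ∞ f) (hW : IsSmoothField W) :
    mlieBracket I X (mlieBracket I Y (f • W)) =
      derivAlong X (derivAlong Y f) • W + derivAlong Y f • mlieBracket I X W
        + (derivAlong X f • mlieBracket I Y W + f • mlieBracket I X (mlieBracket I Y W)) := by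
  have hYf := hY.derivAlong hf
  have hYW := hY.mlieBracket hW
  rw [← mlieBracket_smul hYf hW, ← mlieBracket_smul hf hYW, mlieBracket_smul hf hW]
  funext x
  exact mlieBracket_add_right ((hW.smul hYf).mdiffAt x) ((hYW.smul hf).mdiffAt x)

-- Compare the coefficients of `W` in the Jacobi identity for `X`, `Y` and `f • W`.
lemma derivAlong_mlieBracket (hX : IsSmoothField X) (hY : IsSmoothField Y)
    (hf : ContMDiff I 𝓘(ℝ) ∞ f) :
    derivAlong (mlieBracket I X Y) f
      = derivAlong X (derivAlong Y f) - derivAlong Y (derivAlong X f) := by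
  have key {W : Π x : M, TangentSpace I x} (hW : IsSmoothField W) :
      (derivAlong (mlieBracket I X Y) f
        - (derivAlong X (derivAlong Y f) - derivAlong Y (derivAlong X f))) • W = 0 := by
    have := mlieBracket_jacobi hX hY (hW.smul hf)
    rw [mlieBracket_mlieBracket_smul X hY hf hW, mlieBracket_mlieBracket_smul Y hX hf hW,
      mlieBracket_jacobi hX hY hW, mlieBracket_smul hf hW, smul_add f] at this
    rw [← sub_eq_zero] at this
    rw [← neg_eq_zero, ← this]
    module
  funext x
  by_contra hne
  have vanish {W : Π x : M, TangentSpace I x} (hW : IsSmoothField W) : W x = 0 :=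
    (smul_eq_zero.1 (congrFun (key hW) x)).resolve_left (sub_ne_zero.2 hne)
  exact hne (by simp [derivAlong, vanish hX, vanish hY, vanish (hX.mlieBracket hY)])

lemma derivAlong_extD {η : Π x : M, TangentSpace I x →L[ℝ] ℝ} (hη : IsSmoothForm η)
    (X : Π x : M, TangentSpace I x) (hY : IsSmoothField Y) (hZ : IsSmoothField Z) :
    derivAlong X (extD η Y Z) = (1 / 2 : ℝ) • (derivAlong X (derivAlong Y fun x ↦ η x (Z x))
      - derivAlong X (derivAlong Z fun x ↦ η x (Y x))
      - derivAlong X fun x ↦ η x (mlieBracket I Y Z x)) := by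
  have hYZ := hY.derivAlong (hη.apply hZ)
  have hZY := hZ.derivAlong (hη.apply hY)
  have hbr := hη.apply (hY.mlieBracket hZ)
  rw [← derivAlong_sub X hYZ hZY, ← derivAlong_sub X (f := _ - _) (hYZ.sub hZY) hbr]
  exact derivAlong_const_smul X (1 / 2) ((hYZ.sub hZY).sub hbr)

lemma extD_extD_eq_zero {η : Π x : M, TangentSpace I x →L[ℝ] ℝ} (hη : IsSmoothForm η)
    (hX : IsSmoothField X) (hY : IsSmoothField Y) (hZ : IsSmoothField Z) :
    derivAlong X (extD η Y Z) - derivAlong Y (extD η X Z) + derivAlong Z (extD η X Y)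
      - extD η (mlieBracket I X Y) Z + extD η (mlieBracket I X Z) Y
      - extD η (mlieBracket I Y Z) X = 0 := by
  funext x
  have jacobi := congrArg (η x) (congrFun (mlieBracket_jacobi hX hY hZ) x)
  rw [Pi.add_apply, mlieBracket_swap_apply (V := X) (W := mlieBracket I Y Z),
    mlieBracket_swap_apply (V := Y) (W := mlieBracket I X Z)] at jacobi
  have XY := congrFun (derivAlong_mlieBracket hX hY (hη.apply hZ)) x
  have XZ := congrFun (derivAlong_mlieBracket hX hZ (hη.apply hY)) x
  have YZ := congrFun (derivAlong_mlieBracket hY hZ (hη.apply hX)) x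
  rw [derivAlong_extD hη X hY hZ, derivAlong_extD hη Y hX hZ, derivAlong_extD hη Z hX hY]
  simp only [extD, derivAlong, Pi.add_apply, Pi.sub_apply, Pi.smul_apply, Pi.zero_apply,
    smul_eq_mul, map_add, map_neg] at *
  linarith

end Bracket

lemma exists_isSmoothField_eq [FiniteDimensional ℝ E] [T2Space M] (x : M) (v : TangentSpace I x) :
    ∃ X : Π y : M, TangentSpace I y, IsSmoothField X ∧ X x = v := by
  obtain ⟨s, hs, hsm⟩ := exists_contMDiffOn_extend (k := ∞) I E v
  obtain ⟨t, hts, ht, hxt⟩ := mem_nhds_iff.1 hs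
  obtain ⟨f, -, hf⟩ := (SmoothBumpFunction.nhds_basis_tsupport (I := I) x).mem_iff.1
    (ht.mem_nhds hxt)
  refine ⟨(f : M → ℝ) • extend E v, fun y ↦ ?_, by simp⟩
  by_cases hy : y ∈ t
  · exact ContMDiffAt.smul_section f.contMDiffAt
      ((hsm y (hts hy)).contMDiffAt (Filter.mem_of_superset (ht.mem_nhds hy) hts))
  · have hyf : y ∉ tsupport f := fun h ↦ hy (hf h)
    have hzero : ContMDiffAt I I.tangent ∞ (T% (0 : Π y : M, TangentSpace I y)) y :=
      contMDiff_zeroSection ..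
    refine hzero.congr_of_eventuallyEq ?_
    filter_upwards [(isClosed_tsupport f).isOpen_compl.mem_nhds hyf] with z hz
    simp [image_eq_zero_of_notMem_tsupport hz]

end VectorFields

section Pfaffian

open Equiv
open scoped Kronecker

lemma sum_perm_option_eq_sum_perm {ι R : Type*} [Fintype ι] [DecidableEq ι] [AddCommMonoid R]
    {F : Perm (Option ι) → R} (hF : ∀ σ, σ none ≠ none → F σ = 0) :
    ∑ σ, F σ = ∑ ρ : Perm ι, F ρ.optionCongr := by
  rw [← Perm.decomposeOption.symm.sum_comp, Fintype.sum_prod_type, Fintype.sum_option]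
  have fixed (ρ : Perm ι) : Perm.decomposeOption.symm (none, ρ) = ρ.optionCongr := by
    simp [Perm.decomposeOption, Perm.one_def]
  have moved (i : ι) (ρ : Perm ι) : F (Perm.decomposeOption.symm (some i, ρ)) = 0 :=
    hF _ (by simp)
  simp only [fixed, moved, Finset.sum_const_zero, add_zero]

lemma sign_of_apply_eq {α β : Type*} [Fintype α] [DecidableEq α] [Fintype β] [DecidableEq β]
    {ρ : Perm (α × β)} {τ : Perm α} {s : α → Perm β} (h : ∀ a b, ρ (a, b) = (τ a, s a b)) :
    Perm.sign ρ = Perm.sign τ ^ Fintype.card β * ∏ a, Perm.sign (s a) := by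
  have : ρ = prodCongrLeft (fun _ : β ↦ τ) * prodCongrRight s := by
    ext1 ⟨a, b⟩
    simp [h]
  rw [this, map_mul, Perm.sign_prodCongrLeft, Perm.sign_prodCongrRight]
  simp

lemma exists_perm_apply_eq {α β : Type*} [Finite α] [Finite β] [Nonempty β]
    {ρ : Perm (α × β)} (h : ∀ a b b', (ρ (a, b)).1 = (ρ (a, b')).1) :
    ∃ (τ : Perm α) (s : α → Perm β), ∀ a b, ρ (a, b) = (τ a, s a b) := by
  obtain ⟨b₀⟩ := ‹Nonempty β›
  have surj : Function.Surjective fun a ↦ (ρ (a, b₀)).1 := fun c ↦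
    ⟨(ρ.symm (c, b₀)).1, by simp [h _ b₀ (ρ.symm (c, b₀)).2]⟩
  have inj (a : α) : Function.Injective fun b ↦ (ρ (a, b)).2 := fun b b' hb ↦
    congrArg Prod.snd (ρ.injective (Prod.ext (h a b b') hb))
  exact ⟨.ofBijective _ (Finite.surjective_iff_bijective.1 surj),
    fun a ↦ .ofBijective _ (Finite.injective_iff_bijective.1 (inj a)),
    fun a b ↦ Prod.ext (h a b b₀) rfl⟩

/-- The matrix of the standard symplectic form in a basis of pairs `(eᵢ, fᵢ)`, indexed by
`(i, 0)` and `(i, 1)`. The sign `ω(eᵢ, fᵢ) = -1` is that of `g(e, φ f)` for `f = φ e`. -/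
def stdSymplectic (ι : Type*) [DecidableEq ι] : Matrix (ι × Fin 2) (ι × Fin 2) ℝ :=
  1 ⊗ₖ !![0, -1; 1, 0]

variable {ι : Type*} [Fintype ι] [DecidableEq ι]

lemma sign_mul_prod_stdSymplectic {ρ : Perm (ι × Fin 2)}
    (h : ∀ i, stdSymplectic ι (ρ (i, 0)) (ρ (i, 1)) ≠ 0) :
    (Perm.sign ρ : ℝ) * ∏ i, stdSymplectic ι (ρ (i, 0)) (ρ (i, 1)) = (-1) ^ Fintype.card ι := by
  have same (i : ι) : (ρ (i, 0)).1 = (ρ (i, 1)).1 := by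
    by_contra hne
    exact h i (by simp [stdSymplectic, hne])
  obtain ⟨τ, s, hρ⟩ := exists_perm_apply_eq (ρ := ρ) fun i b b' ↦ by
    fin_cases b <;> fin_cases b' <;> simp [same]
  have pair (t : Perm (Fin 2)) : (Perm.sign t : ℝ) * !![0, -1; 1, (0 : ℝ)] (t 0) (t 1) = -1 := by
    obtain rfl | rfl : t = 1 ∨ t = swap 0 1 := by revert t; decide
    all_goals simp
  simp only [sign_of_apply_eq hρ, hρ, stdSymplectic, Matrix.kroneckerMap_apply,
    Matrix.one_apply_eq, one_mul, Fintype.card_fin, Int.units_sq, Units.coe_prod,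
    Int.cast_prod, ← Finset.prod_mul_distrib, pair, Finset.prod_const, Finset.card_univ]

lemma sum_sign_mul_prod_stdSymplectic_ne_zero :
    ∑ ρ : Perm (ι × Fin 2), (Perm.sign ρ : ℝ) * ∏ i, stdSymplectic ι (ρ (i, 0)) (ρ (i, 1)) ≠ 0 := by
  suffices 0 < (-1) ^ Fintype.card ι * ∑ ρ : Perm (ι × Fin 2),
      (Perm.sign ρ : ℝ) * ∏ i, stdSymplectic ι (ρ (i, 0)) (ρ (i, 1)) from
    right_ne_zero_of_mul this.ne'
  rw [Finset.mul_sum]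
  refine Finset.sum_pos' (fun ρ _ ↦ ?_) ⟨1, Finset.mem_univ _, ?_⟩
  · by_cases h : ∀ i, stdSymplectic ι (ρ (i, 0)) (ρ (i, 1)) ≠ 0
    · simp [sign_mul_prod_stdSymplectic h, ← mul_pow]
    · push Not at h
      obtain ⟨i, hi⟩ := h
      simp [Finset.prod_eq_zero (f := fun i ↦ stdSymplectic ι (ρ (i, 0)) (ρ (i, 1)))
        (Finset.mem_univ i) hi]
  · simp [stdSymplectic, ← mul_pow]

/-- The enumeration of a Darboux-type basis used by `wedgeContact`: `none` has index `0`, and the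
members of the `i`-th pair have indices `2 * i + 1` and `2 * i + 2`. -/
def pairIndexEquiv (n : ℕ) : Option (Fin n × Fin 2) ≃ Fin (2 * n + 1) :=
  (finProdFinEquiv.trans (finCongr (Nat.mul_comm n 2))).optionCongr.trans
    (finSuccEquiv (2 * n)).symm

variable {n : ℕ}

lemma pairIndexEquiv_none : pairIndexEquiv n none = 0 := by
  simp [pairIndexEquiv]

lemma pairIndexEquiv_some_zero (i : Fin n) :
    pairIndexEquiv n (some (i, 0)) = ⟨2 * i + 1, by lia⟩ := by
  ext; simp [pairIndexEquiv]

lemma pairIndexEquiv_some_one (i : Fin n) :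
    pairIndexEquiv n (some (i, 1)) = ⟨2 * i + 2, by lia⟩ := by
  ext; simp [pairIndexEquiv]; lia

lemma sum_sign_mul_prod_ne_zero {a : Fin (2 * n + 1) → ℝ}
    {w : Fin (2 * n + 1) → Fin (2 * n + 1) → ℝ}
    (ha : ∀ p, a (pairIndexEquiv n p) = if p = none then 1 else 0)
    (hw : ∀ p q, w (pairIndexEquiv n (some p)) (pairIndexEquiv n (some q))
      = stdSymplectic (Fin n) p q) :
    ∑ σ : Perm (Fin (2 * n + 1)), (Perm.sign σ : ℝ) * (a (σ 0) *
      ∏ i : Fin n, w (σ ⟨2 * i + 1, by lia⟩) (σ ⟨2 * i + 2, by lia⟩)) ≠ 0 := by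
  rw [← (pairIndexEquiv n).permCongr.sum_comp, sum_perm_option_eq_sum_perm]
  · simpa [← pairIndexEquiv_none, ← pairIndexEquiv_some_zero, ← pairIndexEquiv_some_one, ha, hw]
      using sum_sign_mul_prod_stdSymplectic_ne_zero (ι := Fin n)
  · intro σ hσ
    simp [← pairIndexEquiv_none, ha, hσ]

end Pfaffian

section Isotropic

lemma exists_mem_orthogonal_norm_eq_one {𝕜 V : Type*} [RCLike 𝕜] [NormedAddCommGroup V]
    [InnerProductSpace 𝕜 V] {S : Submodule 𝕜 V}
    [S.HasOrthogonalProjection] (hS : S ≠ ⊤) : ∃ v ∈ Sᗮ, ‖v‖ = 1 := by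
  obtain ⟨v, hv, hv₀⟩ := Submodule.exists_mem_ne_zero_of_ne_bot
    (mt Submodule.orthogonal_eq_bot_iff.1 hS)
  exact ⟨(‖v‖⁻¹ : 𝕜) • v, Submodule.smul_mem _ _ hv, norm_smul_inv_norm hv₀⟩

variable {V : Type*} [NormedAddCommGroup V] [InnerProductSpace ℝ V]

lemma exists_orthonormal_isotropic {J : V →ₗ[ℝ] V}
    (hJ : ∀ u v, inner ℝ (J u) v = -inner ℝ u (J v)) (ξ : V) {k : ℕ}
    (hk : 2 * k < Module.finrank ℝ V) :
    ∃ e : Fin k → V, Orthonormal ℝ e ∧ (∀ i, inner ℝ (e i) ξ = 0) ∧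
      ∀ i j, inner ℝ (e i) (J (e j)) = 0 := by
  induction k with
  | zero => exact ⟨![], ⟨fun i ↦ i.elim0, Subsingleton.pairwise⟩, (·.elim0), (·.elim0)⟩
  | succ k ih =>
    obtain ⟨e, he, heξ, heJ⟩ := ih (by lia)
    -- A unit vector orthogonal to `ξ`, to the `e i` and to the `J (e i)` extends the family.
    let b : Option (Fin k ⊕ Fin k) → V := fun o ↦ o.elim ξ (Sum.elim e (J ∘ e))
    have hb : Submodule.span ℝ (Set.range b) ≠ ⊤ := fun htop ↦ by
      have := finrank_range_le_card (R := ℝ) b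
      rw [Set.finrank, htop, finrank_top, Fintype.card_option, Fintype.card_sum,
        Fintype.card_fin] at this
      lia
    have := FiniteDimensional.span_of_finite ℝ (Set.finite_range b)
    obtain ⟨v, hv, hv₁⟩ := exists_mem_orthogonal_norm_eq_one hb
    have hvb (o) : inner ℝ v (b o) = 0 :=
      Submodule.inner_left_of_mem_orthogonal (Submodule.subset_span (Set.mem_range_self o)) hv
    have hve (i) : inner ℝ v (e i) = 0 := hvb (some (.inl i))
    have hvJe (i) : inner ℝ v (J (e i)) = 0 := hvb (some (.inr i))
    have heJv (i) : inner ℝ (e i) (J v) = 0 := by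
      rw [← neg_eq_zero, ← hJ, real_inner_comm, hvJe]
    have hvJv : inner ℝ v (J v) = 0 := self_eq_neg.1 (by rw [← hJ, real_inner_comm])
    refine ⟨Matrix.vecCons v e, orthonormal_vecCons_iff.2 ⟨hv₁, hve, he⟩, ?_, ?_⟩
    · exact Fin.cases (hvb none) heξ
    · exact Fin.cases (Fin.cases hvJv hvJe) fun i ↦ Fin.cases (heJv i) (heJ i)

lemma inner_mul_inner_sub_inner_sq_ne_zero {u v : V}
    (h : LinearIndependent ℝ ![u, v]) : inner ℝ u u * inner ℝ v v - inner ℝ u v ^ 2 ≠ 0 := by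
  simpa [Matrix.det_fin_two, Matrix.gram, real_inner_comm, sq, -inner_self_eq_norm_sq_to_K] using
    Matrix.det_gram_ne_zero_iff_linearIndependent.2 h

end Isotropic

section AlmostContact

variable {E : Type*} [NormedAddCommGroup E] [NormedSpace ℝ E]
  {H : Type*} [TopologicalSpace H] {I : ModelWithCorners ℝ E H}
  {M : Type*} [TopologicalSpace M] [ChartedSpace H M] [IsManifold I ∞ M]
  {φ Q : Π x : M, TangentSpace I x →L[ℝ] TangentSpace I x}
  {ξ : Π x : M, TangentSpace I x} {η : Π x : M, TangentSpace I x →L[ℝ] ℝ}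

namespace IsWeakAlmostContact

variable (h : IsWeakAlmostContact φ Q ξ η) (x : M)
include h

lemma phi_xi : φ x (ξ x) = 0 := by
  have phi_phi_xi : φ x (φ x (ξ x)) = 0 := by simp [h.phi_sq, h.Q_xi, h.eta_xi]
  have parallel : φ x (ξ x) = η x (φ x (ξ x)) • ξ x := by
    refine (h.nonsingular x).1 ?_
    rw [map_smul, h.Q_xi, ← neg_add_eq_zero, ← h.phi_sq, phi_phi_xi, map_zero]
  have coeff : η x (φ x (ξ x)) = 0 := by
    have := congrArg (η x ∘ φ x) parallel
    simpa [phi_phi_xi] using this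
  rw [parallel, coeff, zero_smul]

lemma eta_phi (u : TangentSpace I x) : η x (φ x u) = 0 := by
  simpa [h.phi_xi] using h.ker_invariant x (u - η x u • ξ x) (by simp [h.eta_xi])

lemma Q_phi (u : TangentSpace I x) : Q x (φ x u) = φ x (Q x u) := by
  have := h.phi_sq x (φ x u)
  simpa [h.phi_sq, h.phi_xi, h.eta_phi, eq_comm] using this

lemma eq_zero_of_phi_eq_zero {u : TangentSpace I x} (hφ : φ x u = 0) (hη : η x u = 0) : u = 0 := by
  have := h.phi_sq x u
  rw [hφ, hη, map_zero, zero_smul, add_zero, zero_eq_neg] at this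
  exact (h.nonsingular x).1 (this.trans (map_zero _).symm)

end IsWeakAlmostContact

variable [RiemannianBundle (fun x : M ↦ TangentSpace I x)]

namespace IsWeakAlmostContactMetric

variable (h : IsWeakAlmostContactMetric φ Q ξ η)
include h

lemma inner_xi (x : M) (u : TangentSpace I x) : inner ℝ u (ξ x) = η x u := by
  have := h.compatible x u (ξ x)
  rw [h.phi_xi, h.Q_xi, h.eta_xi, inner_zero_right, mul_one] at this
  exact sub_eq_zero.1 this.symm

lemma ip_xi (X : Π x : M, TangentSpace I x) : ip X ξ = fun x ↦ η x (X x) :=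
  funext fun x ↦ h.inner_xi x (X x)

lemma inner_phi_left (x : M) (u v : TangentSpace I x) :
    inner ℝ (φ x u) v = -inner ℝ u (φ x v) := by
  obtain ⟨w, rfl⟩ := (h.nonsingular x).2 v
  have := h.compatible x u (φ x w)
  rw [h.phi_sq, h.Q_phi, h.eta_phi, inner_add_right, inner_neg_right, inner_smul_right,
    h.inner_xi, h.eta_phi] at this
  linarith

end IsWeakAlmostContactMetric

lemma IsAlmostContactMetric.phi_phi (h : IsAlmostContactMetric φ ξ η) (x : M)
    (u : TangentSpace I x) : φ x (φ x u) = -u + η x u • ξ x :=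
  h.phi_sq x u

lemma IsAlmostContactMetric.exists_phi_basis (h : IsAlmostContactMetric φ ξ η) {n : ℕ}
    (hn : 2 * n < Module.finrank ℝ E) (x : M) :
    ∃ b : Option (Fin n × Fin 2) → TangentSpace I x,
      (∀ p, η x (b p) = if p = none then 1 else 0) ∧
      ∀ p q, inner ℝ (b (some p)) (φ x (b (some q))) = stdSymplectic (Fin n) p q := by
  have hφ := h.inner_phi_left x
  obtain ⟨e, he, heξ, heφ⟩ := exists_orthonormal_isotropic (J := (φ x).toLinearMap) hφ (ξ x) hn
  have hηe (i) : η x (e i) = 0 := by rw [← h.inner_xi, heξ]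
  have hφφe (i) : φ x (φ x (e i)) = -e i := by rw [h.phi_phi, hηe, zero_smul, add_zero]
  have hee (i j) : inner ℝ (e i) (e j) = if i = j then (1 : ℝ) else 0 :=
    orthonormal_iff_ite.1 he i j
  have heφ' (i j) : inner ℝ (e i) (φ x (e j)) = 0 := heφ i j
  refine ⟨fun p ↦ p.elim (ξ x) fun q ↦ ![e q.1, φ x (e q.1)] q.2, ?_, ?_⟩
  · rintro (_ | ⟨i, b⟩)
    · simp [h.eta_xi]
    · fin_cases b <;> simp [h.eta_phi, hηe]
  · rintro ⟨i, b⟩ ⟨j, c⟩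
    fin_cases b <;> fin_cases c <;>
      simp [stdSymplectic, Matrix.one_apply, hφ, hφφe, hee, heφ', apply_ite]

lemma IsWeakContactMetric.isContactForm [FiniteDimensional ℝ E] [T2Space M]
    (h : IsWeakContactMetric φ (fun x ↦ ContinuousLinearMap.id ℝ (TangentSpace I x)) ξ η) {n : ℕ}
    (hn : Module.finrank ℝ E = 2 * n + 1) : IsContactForm n η := by
  intro x
  obtain ⟨b, hηb, hφb⟩ :=
    IsAlmostContactMetric.exists_phi_basis h.toIsWeakAlmostContactMetric (by lia : 2 * n < _) x
  choose X hX hXb using fun i ↦ exists_isSmoothField_eq x (b ((pairIndexEquiv n).symm i))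
  refine ⟨X, hX, mul_ne_zero (by positivity) ?_⟩
  refine sum_sign_mul_prod_ne_zero (a := fun i ↦ η x (X i x))
    (w := fun i j ↦ extD η (X i) (X j) x) (fun p ↦ ?_) fun p q ↦ ?_
  · simpa [hXb] using hηb p
  · simpa [h.extD_eq _ _ (hX _) (hX _), hXb] using hφb p q

end AlmostContact

section Connection

variable {E : Type*} [NormedAddCommGroup E] [NormedSpace ℝ E] [FiniteDimensional ℝ E]
  {H : Type*} [TopologicalSpace H] {I : ModelWithCorners ℝ E H}
  {M : Type*} [TopologicalSpace M] [ChartedSpace H M] [IsManifold I ∞ M]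
  [RiemannianBundle (fun x : M ↦ TangentSpace I x)]
  [IsContMDiffRiemannianBundle I ∞ E (fun x : M ↦ TangentSpace I x)]
  {φ : Π x : M, TangentSpace I x →L[ℝ] TangentSpace I x}
  {X Y Z : Π x : M, TangentSpace I x}

lemma nabla_zero_right (X : Π x : M, TangentSpace I x) : nabla X 0 = 0 := by
  funext x
  have : leviCivita I M 0 = 0 := CovariantDerivative.zero _
  exact congrArg (fun A ↦ A x (X x)) this

lemma nabla_add_right (X : Π x : M, TangentSpace I x) (hY : IsSmoothField Y)
    (hZ : IsSmoothField Z) : nabla X (Y + Z) = nabla X Y + nabla X Z := by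
  funext x
  have := (leviCivita I M).isCovariantDerivativeOnUniv.add (hY.mdiffAt x) (hZ.mdiffAt x)
  exact congrArg (fun A ↦ A (X x)) this

lemma nabla_neg_right (X : Π x : M, TangentSpace I x) (hY : IsSmoothField Y) :
    nabla X (-Y) = -nabla X Y := by
  funext x
  have := (leviCivita I M).isCovariantDerivativeOnUniv.smul_const (-1) (hY.mdiffAt x)
  rw [neg_one_smul, neg_one_smul] at this
  exact congrArg (fun A ↦ A (X x)) this

lemma nabla_sub_nabla (hX : IsSmoothField X) (hY : IsSmoothField Y) :
    nabla X Y - nabla Y X = mlieBracket I X Y :=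
  funext fun x ↦
    (CovariantDerivative.torsion_eq_zero_iff _).1 leviCivita_torsion (hX.mdiffAt x) (hY.mdiffAt x)

lemma derivAlong_ip (X : Π x : M, TangentSpace I x) (hY : IsSmoothField Y)
    (hZ : IsSmoothField Z) : derivAlong X (ip Y Z) = ip (nabla X Y) Z + ip Y (nabla X Z) :=
  funext fun x ↦ leviCivita_metric (hY.mdiffAt x) (hZ.mdiffAt x) (X x)

lemma nablaEnd_add_left (X Y Z : Π x : M, TangentSpace I x) :
    nablaEnd φ (X + Y) Z = nablaEnd φ X Z + nablaEnd φ Y Z := by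
  funext x
  simp only [nablaEnd, nabla, Pi.add_apply, map_add]
  abel

lemma nablaEnd_add_right (hφ : IsSmoothEnd φ) (X : Π x : M, TangentSpace I x)
    (hY : IsSmoothField Y) (hZ : IsSmoothField Z) :
    nablaEnd φ X (Y + Z) = nablaEnd φ X Y + nablaEnd φ X Z := by
  have nabla_phi_add : nabla X (fun y ↦ φ y ((Y + Z) y))
      = nabla X (fun y ↦ φ y (Y y)) + nabla X (fun y ↦ φ y (Z y)) := by
    rw [← nabla_add_right X (hφ.apply hY) (hφ.apply hZ)]
    congr 1
    exact funext fun y ↦ map_add _ _ _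
  funext x
  rw [nablaEnd, nabla_phi_add, nabla_add_right X hY hZ]
  simp only [nablaEnd, Pi.add_apply, map_add]
  abel

lemma derivAlong_ip_end (hφ : IsSmoothEnd φ) (X : Π x : M, TangentSpace I x)
    (hY : IsSmoothField Y) (hZ : IsSmoothField Z) (x : M) :
    derivAlong X (ip Y fun y ↦ φ y (Z y)) x = inner ℝ (nabla X Y x) (φ x (Z x))
      + inner ℝ (Y x) (nablaEnd φ X Z x) + inner ℝ (Y x) (φ x (nabla X Z x)) := by
  rw [derivAlong_ip X hY (hφ.apply hZ), nablaEnd, inner_sub_right]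
  simp only [ip, Pi.add_apply]
  ring

lemma inner_nablaEnd_of_skew (hφ : IsSmoothEnd φ)
    (hskew : ∀ x (u v : TangentSpace I x), inner ℝ (φ x u) v = -inner ℝ u (φ x v))
    (X : Π x : M, TangentSpace I x) (hY : IsSmoothField Y) (hZ : IsSmoothField Z) (x : M) :
    inner ℝ (nablaEnd φ X Y x) (Z x) = -inner ℝ (Y x) (nablaEnd φ X Z x) := by
  have skew_fields : ip Z (fun y ↦ φ y (Y y)) = -ip Y fun y ↦ φ y (Z y) :=
    funext fun y ↦ by rw [Pi.neg_apply, ip, ip, ← hskew, real_inner_comm]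
  have hYZ := derivAlong_ip_end hφ X hY hZ x
  have hZY := derivAlong_ip_end hφ X hZ hY x
  rw [skew_fields, derivAlong_neg, Pi.neg_apply, hYZ, real_inner_comm (φ x (Y x)), hskew,
    real_inner_comm (φ x (nabla X Y x)), hskew, real_inner_comm (nablaEnd φ X Y x)] at hZY
  linarith

end Connection

section Structures

variable {E : Type*} [NormedAddCommGroup E] [NormedSpace ℝ E] [FiniteDimensional ℝ E]
  {H : Type*} [TopologicalSpace H] {I : ModelWithCorners ℝ E H}
  {M : Type*} [TopologicalSpace M] [ChartedSpace H M] [IsManifold I ∞ M]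
  [RiemannianBundle (fun x : M ↦ TangentSpace I x)]
  [IsContMDiffRiemannianBundle I ∞ E (fun x : M ↦ TangentSpace I x)]
  {φ Q : Π x : M, TangentSpace I x →L[ℝ] TangentSpace I x}
  {ξ : Π x : M, TangentSpace I x} {η : Π x : M, TangentSpace I x →L[ℝ] ℝ}
  {X Y Z : Π x : M, TangentSpace I x}

lemma IsWeakAlmostContact.nablaEnd_xi (h : IsWeakAlmostContact φ Q ξ η)
    (X : Π x : M, TangentSpace I x) (x : M) : nablaEnd φ X ξ x = -φ x (nabla X ξ x) := by
  have phi_xi : (fun y ↦ φ y (ξ y)) = 0 := funext h.phi_xi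
  rw [nablaEnd, phi_xi, nabla_zero_right, Pi.zero_apply, zero_sub]

lemma nabla_xi_of_hTensor_eq_zero (hh : ∀ x, hTensor φ ξ x = 0)
    (X : Π x : M, TangentSpace I x) : nabla X ξ = -fun x ↦ φ x (X x) :=
  funext fun x ↦ eq_neg_of_add_eq_zero_left (congrArg (fun A ↦ A (X x)) (hh x))

lemma IsWeakAlmostContactMetric.isWeakContactMetric_of_hTensor_eq_zero
    (h : IsWeakAlmostContactMetric φ Q ξ η) (hh : ∀ x, hTensor φ ξ x = 0) :
    IsWeakContactMetric φ Q ξ η where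
  toIsWeakAlmostContactMetric := h
  extD_eq X Y hX hY x := by
    have derivAlong_eta {V W : Π x : M, TangentSpace I x} (hW : IsSmoothField W) :
        derivAlong V (fun x ↦ η x (W x)) x
          = η x (nabla V W x) - inner ℝ (W x) (φ x (V x)) := by
      rw [← h.ip_xi, derivAlong_ip V hW h.smooth_xi, nabla_xi_of_hTensor_eq_zero hh]
      simp only [Pi.add_apply, ip, h.inner_xi, Pi.neg_apply, inner_neg_right, sub_eq_add_neg]
    have bracket := congrArg (η x) (congrFun (nabla_sub_nabla hX hY) x)
    have skew := h.inner_phi_left x (X x) (Y x)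
    rw [real_inner_comm] at skew
    rw [Pi.sub_apply, map_sub] at bracket
    change 1 / 2 * (derivAlong X (fun x ↦ η x (Y x)) x - derivAlong Y (fun x ↦ η x (X x)) x
      - η x (mlieBracket I X Y x)) = _
    rw [derivAlong_eta hY, derivAlong_eta hX, ← bracket, skew]
    ring

-- This is `dΦ = 0` for the fundamental form `Φ(X, Y) = g(X, φ Y) = dη(X, Y)`.
lemma IsWeakContactMetric.cyclic_sum_inner_nablaEnd_eq_zero (h : IsWeakContactMetric φ Q ξ η)
    (hX : IsSmoothField X) (hY : IsSmoothField Y) (hZ : IsSmoothField Z) (x : M) :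
    inner ℝ (X x) (nablaEnd φ Y Z x) + inner ℝ (Y x) (nablaEnd φ Z X x)
      + inner ℝ (Z x) (nablaEnd φ X Y x) = 0 := by
  have extD_eq {V W : Π x : M, TangentSpace I x} (hV : IsSmoothField V)
      (hW : IsSmoothField W) : extD η V W = ip V fun y ↦ φ y (W y) :=
    funext (h.extD_eq V W hV hW)
  have skew (V W : Π x : M, TangentSpace I x) :
      inner ℝ (V x) (φ x (W x)) = -inner ℝ (W x) (φ x (V x)) := by
    rw [real_inner_comm, h.inner_phi_left]
  have skew_nablaEnd {V W : Π x : M, TangentSpace I x} (U : Π x : M, TangentSpace I x)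
      (hV : IsSmoothField V) (hW : IsSmoothField W) :
      inner ℝ (V x) (nablaEnd φ U W x) = -inner ℝ (W x) (nablaEnd φ U V x) := by
    rw [real_inner_comm, inner_nablaEnd_of_skew h.smooth_phi h.inner_phi_left U hW hV]
  have closed := congrFun (extD_extD_eq_zero h.smooth_eta hX hY hZ) x
  rw [extD_eq hY hZ, extD_eq hX hZ, extD_eq hX hY, extD_eq (hX.mlieBracket hY) hZ,
    extD_eq (hX.mlieBracket hZ) hY, extD_eq (hY.mlieBracket hZ) hX,
    ← nabla_sub_nabla hX hY, ← nabla_sub_nabla hX hZ, ← nabla_sub_nabla hY hZ] at closed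
  simp only [Pi.add_apply, Pi.sub_apply, Pi.zero_apply,
    derivAlong_ip_end h.smooth_phi X hY hZ, derivAlong_ip_end h.smooth_phi Y hX hZ,
    derivAlong_ip_end h.smooth_phi Z hX hY, ip, inner_sub_left] at closed
  linarith [skew_nablaEnd X hY hZ, skew_nablaEnd Z hX hY, skew Y (nabla X Z),
    skew X (nabla Y Z), skew X (nabla Z Y)]

lemma IsWeakNearlySasakian.nablaEnd_add_nablaEnd_swap (h : IsWeakNearlySasakian φ Q ξ η)
    (hX : IsSmoothField X) (hY : IsSmoothField Y) (x : M) :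
    nablaEnd φ X Y x + nablaEnd φ Y X x
      = (2 * inner ℝ (X x) (Y x)) • ξ x - η x (X x) • Y x - η x (Y x) • X x := by
  have polarized := h.nearly _ (hX.add hY) x
  rw [nablaEnd_add_left, nablaEnd_add_right h.smooth_phi _ hX hY,
    nablaEnd_add_right h.smooth_phi _ hX hY] at polarized
  simp only [Pi.add_apply, h.nearly X hX, h.nearly Y hY, real_inner_add_add_self, map_add]
    at polarized
  linear_combination (norm := module) polarized

lemma IsWeakNearlySasakian.nablaEnd_eq [T2Space M] (h : IsWeakNearlySasakian φ Q ξ η)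
    (hc : IsWeakContactMetric φ Q ξ η) (hX : IsSmoothField X) (hY : IsSmoothField Y) (x : M) :
    nablaEnd φ X Y x = inner ℝ (X x) (Y x) • ξ x - η x (Y x) • X x := by
  refine ext_inner_left ℝ fun v ↦ ?_
  obtain ⟨Z, hZ, rfl⟩ := exists_isSmoothField_eq x v
  have cyclic := hc.cyclic_sum_inner_nablaEnd_eq_zero hX hY hZ x
  have XY := congrArg (inner ℝ (Z x)) (h.nablaEnd_add_nablaEnd_swap hX hY x)
  have YZ := congrArg (inner ℝ (X x)) (h.nablaEnd_add_nablaEnd_swap hY hZ x)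
  have skew_Y := inner_nablaEnd_of_skew h.smooth_phi h.inner_phi_left Y hX hZ x
  have skew_Z := inner_nablaEnd_of_skew h.smooth_phi h.inner_phi_left Z hX hY x
  rw [real_inner_comm] at skew_Y skew_Z
  simp only [inner_add_right, inner_sub_right, inner_smul_right, h.inner_xi] at XY YZ ⊢
  rw [real_inner_comm (Z x) (X x), real_inner_comm (Z x) (Y x)] at YZ
  linarith

lemma IsWeakNearlySasakian.QTilde_eq_zero_of_hTensor_eq_zero [T2Space M]
    (h : IsWeakNearlySasakian φ Q ξ η) (hh : ∀ x, hTensor φ ξ x = 0) (x : M) :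
    QTilde Q x = 0 := by
  ext1 v
  obtain ⟨X, hX, rfl⟩ := exists_isSmoothField_eq x v
  have hc := h.isWeakContactMetric_of_hTensor_eq_zero hh
  have phi_phi : φ x (φ x (X x)) = η x (X x) • ξ x - X x := by
    have := h.nablaEnd_eq hc hX h.smooth_xi x
    rwa [h.nablaEnd_xi, nabla_xi_of_hTensor_eq_zero hh, Pi.neg_apply, map_neg, neg_neg,
      h.inner_xi, h.eta_xi, one_smul] at this
  rw [h.phi_sq, neg_add_eq_sub] at phi_phi
  exact sub_eq_zero.2 (sub_right_injective phi_phi)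

lemma IsWeakNearlySasakian.isSasakian_of_hTensor_eq_zero [T2Space M]
    (h : IsWeakNearlySasakian φ Q ξ η) (hh : ∀ x, hTensor φ ξ x = 0) : IsSasakian φ ξ η := by
  have hc := h.isWeakContactMetric_of_hTensor_eq_zero hh
  have hQ := h.QTilde_eq_zero_of_hTensor_eq_zero hh
  have Q_eq_id : Q = fun x ↦ ContinuousLinearMap.id ℝ (TangentSpace I x) :=
    funext fun x ↦ sub_eq_zero.1 (hQ x)
  subst Q_eq_id
  exact ⟨h.toIsWeakAlmostContactMetric, fun X Y hX hY ↦ h.nablaEnd_eq hc hX hY⟩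

lemma IsSasakian.hTensor_eq_zero [T2Space M] (h : IsSasakian φ ξ η) (x : M) :
    hTensor φ ξ x = 0 := by
  have hm : IsWeakAlmostContactMetric φ _ ξ η := h.almostContactMetric
  ext1 v
  obtain ⟨X, hX, rfl⟩ := exists_isSmoothField_eq x v
  have hTensor_apply : hTensor φ ξ x (X x) = nabla X ξ x + φ x (X x) := rfl
  refine hm.eq_zero_of_phi_eq_zero x ?_ ?_
  · have sasaki := h.sasaki X ξ hX hm.smooth_xi x
    rw [hm.nablaEnd_xi, hm.inner_xi, hm.eta_xi, one_smul] at sasaki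
    rw [hTensor_apply, map_add, h.almostContactMetric.phi_phi, neg_eq_iff_eq_neg.1 sasaki]
    abel
  · have unit : ip ξ ξ = fun _ ↦ (1 : ℝ) := by rw [hm.ip_xi, funext hm.eta_xi]
    have orthogonal := congrFun (derivAlong_ip X hm.smooth_xi hm.smooth_xi) x
    rw [unit, derivAlong, mvfderiv_const, Pi.add_apply, hm.ip_xi, ip_comm, hm.ip_xi] at orthogonal
    rw [hTensor_apply, map_add, hm.eta_phi, add_zero]
    simpa using orthogonal.symm

lemma IsWeakAlmostContact.curvature_xi_xi (h : IsWeakAlmostContact φ Q ξ η)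
    (hh : ∀ x, hTensor φ ξ x = 0) (hX : IsSmoothField X) (x : M) :
    curvature X ξ ξ x = nablaEnd φ ξ X x - φ x (φ x (X x)) := by
  have nabla_xi := nabla_xi_of_hTensor_eq_zero hh
  have nabla_xi_xi : nabla ξ ξ = 0 := by
    rw [nabla_xi]
    exact funext fun y ↦ neg_eq_zero.2 (h.phi_xi y)
  have bracket : mlieBracket I X ξ x = -φ x (X x) - nabla ξ X x := by
    rw [← nabla_sub_nabla hX h.smooth_xi, nabla_xi, Pi.sub_apply, Pi.neg_apply]
  rw [curvature, nabla_xi_xi, nabla_zero_right, nabla_xi X,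
    nabla_neg_right ξ (h.smooth_phi.apply hX), nabla_xi, nablaEnd]
  simp only [Pi.zero_apply, Pi.neg_apply, bracket, map_sub, map_neg]
  abel

lemma IsSasakian.sectionalCurvature_xi [T2Space M] (h : IsSasakian φ ξ η)
    (hX : IsSmoothField X) (x : M) (hli : LinearIndependent ℝ ![ξ x, X x]) :
    sectionalCurvature X ξ x = 1 := by
  have hm : IsWeakAlmostContactMetric φ _ ξ η := h.almostContactMetric
  have curvature_eq : curvature X ξ ξ x = X x - η x (X x) • ξ x := by
    rw [hm.curvature_xi_xi h.hTensor_eq_zero hX, h.sasaki ξ X hm.smooth_xi hX, real_inner_comm,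
      hm.inner_xi, sub_self, zero_sub, h.almostContactMetric.phi_phi]
    abel
  have gram := inner_mul_inner_sub_inner_sq_ne_zero (LinearIndependent.pair_symm_iff.1 hli)
  rw [sectionalCurvature, curvature_eq, ← div_self gram, inner_sub_left, inner_smul_left,
    real_inner_comm (X x) (ξ x), hm.inner_xi, hm.inner_xi, hm.eta_xi, conj_trivial]
  ring

end Structures

end WeakContact

end

theorem proposition4p1_general
    {E : Type*} [NormedAddCommGroup E] [NormedSpace ℝ E] [FiniteDimensional ℝ E]
    {H : Type*} [TopologicalSpace H] {I : ModelWithCorners ℝ E H}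
    {M : Type*} [TopologicalSpace M] [T2Space M] [ChartedSpace H M] [IsManifold I ∞ M]
    [RiemannianBundle (fun x : M ↦ TangentSpace I x)]
    [IsContMDiffRiemannianBundle I ∞ E (fun x : M ↦ TangentSpace I x)]
    {n : ℕ} (hn : Module.finrank ℝ E = 2 * n + 1)
    {φ Q : Π x : M, TangentSpace I x →L[ℝ] TangentSpace I x}
    {ξ : Π x : M, TangentSpace I x} {η : Π x : M, TangentSpace I x →L[ℝ] ℝ}
    (hM : WeakContact.IsWeakNearlySasakian φ Q ξ η) :
    ((∀ x, WeakContact.hTensor φ ξ x = 0) ↔ WeakContact.IsSasakian φ ξ η) ∧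
    ((∀ x, WeakContact.hTensor φ ξ x = 0) →
      (∀ x, WeakContact.QTilde Q x = 0) ∧
      WeakContact.IsWeakContactMetric φ Q ξ η ∧
      WeakContact.IsContactForm n η ∧
      ∀ X : Π x : M, TangentSpace I x, WeakContact.IsSmoothField X →
        ∀ x, LinearIndependent ℝ ![ξ x, X x] → WeakContact.sectionalCurvature X ξ x = 1) := by
  refine ⟨⟨hM.isSasakian_of_hTensor_eq_zero, fun hS ↦ hS.hTensor_eq_zero⟩, fun hh ↦ ?_⟩
  have hS := hM.isSasakian_of_hTensor_eq_zero hh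
  have contactMetric : WeakContact.IsWeakContactMetric φ _ ξ η :=
    hS.almostContactMetric.isWeakContactMetric_of_hTensor_eq_zero hh
  exact ⟨hM.QTilde_eq_zero_of_hTensor_eq_zero hh, hM.isWeakContactMetric_of_hTensor_eq_zero hh,
    contactMetric.isContactForm hn, fun X hX x ↦ hS.sectionalCurvature_xi hX x⟩

theorem proposition4p1 (n : ℕ) (hn : 1 ≤ n)
    {M : Type*} [TopologicalSpace M] [T2Space M]
    [ChartedSpace (EuclideanSpace ℝ (Fin (2 * n + 1))) M] [IsManifold (𝓡 (2 * n + 1)) ∞ M]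
    [RiemannianBundle (fun x : M ↦ TangentSpace (𝓡 (2 * n + 1)) x)]
    [IsContMDiffRiemannianBundle (𝓡 (2 * n + 1)) ∞ (EuclideanSpace ℝ (Fin (2 * n + 1)))
      (fun x : M ↦ TangentSpace (𝓡 (2 * n + 1)) x)]
    (φ Q : Π x : M, TangentSpace (𝓡 (2 * n + 1)) x →L[ℝ] TangentSpace (𝓡 (2 * n + 1)) x)
    (ξ : Π x : M, TangentSpace (𝓡 (2 * n + 1)) x)
    (η : Π x : M, TangentSpace (𝓡 (2 * n + 1)) x →L[ℝ] ℝ)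
    (hM : WeakContact.IsWeakNearlySasakian φ Q ξ η) :
    ((∀ x, WeakContact.hTensor φ ξ x = 0) ↔ WeakContact.IsSasakian φ ξ η) ∧
    ((∀ x, WeakContact.hTensor φ ξ x = 0) →
      (∀ x, WeakContact.QTilde Q x = 0) ∧
      WeakContact.IsWeakContactMetric φ Q ξ η ∧
      WeakContact.IsContactForm n η ∧
      ∀ X : Π x : M, TangentSpace (𝓡 (2 * n + 1)) x, WeakContact.IsSmoothField X →
        ∀ x, LinearIndependent ℝ ![ξ x, X x] → WeakContact.sectionalCurvature X ξ x = 1) :=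
  proposition4p1_general finrank_euclideanSpace_fin hM
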